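/- A diffeological (real) vector space is a real vector space with a diffeology for which addition and scalar multiplication are smooth; $\mathrm{DVect}$ is the category of these spaces and smooth linear maps. A map of diffeological spaces is an induction if it is injective and its source carries the pullback diffeology, and a subduction if it is surjective and its target carries the pushforward (quotient) diffeology. A sequence $0\to A\xrightarrow{i}V\xrightarrow{p}B\to 0$ in $\mathrm{DVect}$ is short exact if it is short exact as a sequence of vector spaces, $i$ is an induction and $p$ is a subduction; it splits smoothly if there is an isomorphism $V\cong A\times B$ in $\mathrm{DVect}$ carrying $i$ to the inclusion $a\mapsto(a,0)$ and $p$ to the projection onto $B$. Linear subspaces, quotients and products carry the sub-, quotient and product diffeologies, and $C^\infty(\mathbb R,\mathbb R)$ carries the functional diffeology. Let $\prod_\omega\mathbb R$ be the product of countably many copies of $\mathbb R$, let $$\phi:C^\infty(\mathbb R,\mathbb R)\to\prod_\omega\mathbb R,\qquad \phi(f)=(f^{(n)}(0))_{n\in\mathbb N},$$ and let $K=\{f\in C^\infty(\mathbb R,\mathbb R)\mid f^{(n)}(0)=0\text{ for all }n\in\mathbb N\}$. Then: 1. $\phi$ is a smooth linear map and a subduction, with kernel $K$, and the induced linear map $\bar\phi:C^\infty(\mathbb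 R,\mathbb R)/K\to\prod_\omega\mathbb R$ is an isomorphism in $\mathrm{DVect}$. 2. (Generalized Borel theorem.) For every $m\in\mathbb N$, every open $U\subseteq\mathbb R^m$ and every sequence of smooth functions $f_k:U\to\mathbb R$ $(k\in\mathbb N)$ there is a smooth function $d:U\times\mathbb R\to\mathbb R$ such that $\frac{\partial^k d}{\partial y^k}(x,0)=f_k(x)$ for all $k\in\mathbb N$ and $x\in U$. 3. The $D$-topology of $\prod_\omega\mathbb R$ is the product topology. 4. There is no smooth linear map $q:\prod_\omega\mathbb R\to C^\infty(\mathbb R,\mathbb R)$ with $\phi\circ q=\mathrm{id}$. 5. $0\to K\to C^\infty(\mathbb R,\mathbb R)\xrightarrow{\phi}\prod_\omega\mathbb R\to 0$ (with the inclusion of $K$) is a short exact sequence in $\mathrm{DVect}$ that does not split smoothly; in particular, there is no smooth linear map $r:C^\infty(\mathbb R,\mathbb R)\to K$ that restricts to the identity on $K$. -/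

import Mathlib

open Diffeology
open scoped ContDiff

noncomputable section

namespace Diffeology

/-! ### Induced (pullback) and coinduced (pushforward) diffeologies -/

/-- The pullback diffeology along `f`: a map `p` is a plot iff `f ∘ p` is a plot. -/
@[reducible]
def induced {X Y : Type*} (f : X → Y) (d : DiffeologicalSpace Y) : DiffeologicalSpace X where
  plots n := {p | IsPlot (f ∘ p)}
  constant_plots x := isPlot_const (x := f x)
  plot_reparam hp hf := isPlot_reparam hp hf
  locality {n p} hp := DiffeologicalSpace.locality (p := f ∘ p) fun x => by
    obtain ⟨u, hu, hxu, h⟩ := hp x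
    exact ⟨u, hu, hxu, fun hg hg' => h hg hg'⟩

/-- The pushforward diffeology along `f`: the finest diffeology making `f` smooth, that is, the
diffeology generated by the maps `f ∘ p` for `p` a plot of the source. -/
@[reducible]
def coinduced {X Y : Type*} (f : X → Y) (d : DiffeologicalSpace X) : DiffeologicalSpace Y :=
  DiffeologicalSpace.generateFrom
    {r | ∃ q : EuclideanSpace ℝ (Fin r.1) → X, IsPlot q ∧ r.2 = f ∘ q}

/-- `f` is an induction: injective, and the source carries the pullback diffeology. -/
def IsInduction {X Y : Type*} [dX : DiffeologicalSpace X] [dY : DiffeologicalSpace Y]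
    (f : X → Y) : Prop :=
  Function.Injective f ∧ dX = induced f dY

/-- `f` is a subduction: surjective, and the target carries the pushforward diffeology. -/
def IsSubduction {X Y : Type*} [dX : DiffeologicalSpace X] [dY : DiffeologicalSpace Y]
    (f : X → Y) : Prop :=
  Function.Surjective f ∧ dY = coinduced f dX

/-! ### Product diffeologies -/

instance instDiffeologicalSpaceProd {X Y : Type*} [dX : DiffeologicalSpace X]
    [dY : DiffeologicalSpace Y] : DiffeologicalSpace (X × Y) :=
  induced Prod.fst dX ⊓ induced Prod.snd dY

instance instDiffeologicalSpacePi {ι : Type*} {X : ι → Type*} [d : ∀ i, DiffeologicalSpace (X i)] :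
    DiffeologicalSpace (∀ i, X i) :=
  ⨅ i, induced (fun x : ∀ i, X i => x i) (d i)

theorem isPlot_prod_iff {X Y : Type*} [DiffeologicalSpace X] [DiffeologicalSpace Y] {n : ℕ}
    {p : EuclideanSpace ℝ (Fin n) → X × Y} :
    IsPlot p ↔ IsPlot (fun x => (p x).1) ∧ IsPlot (fun x => (p x).2) :=
  DiffeologicalSpace.isPlot_inf_iff

theorem isPlot_pi_iff {ι : Type*} {X : ι → Type*} [∀ i, DiffeologicalSpace (X i)] {n : ℕ}
    {p : EuclideanSpace ℝ (Fin n) → ∀ i, X i} :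
    IsPlot p ↔ ∀ i, IsPlot (fun x => p x i) :=
  DiffeologicalSpace.isPlot_iInf_iff

/-! ### Function spaces -/

/-- The set `C^∞(X, Y)` of smooth maps between two diffeological spaces. -/
def SmoothMap (X Y : Type*) [DiffeologicalSpace X] [DiffeologicalSpace Y] : Type _ :=
  {f : X → Y // DSmooth f}

instance instFunLikeSmoothMap {X Y : Type*} [DiffeologicalSpace X] [DiffeologicalSpace Y] :
    FunLike (SmoothMap X Y) X Y where
  coe f := f.1
  coe_injective _ _ h := Subtype.ext h

/-- The functional diffeology: `p` is a plot iff `(u, x) ↦ p u x` is smooth. -/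
instance instDiffeologicalSpaceSmoothMap {X Y : Type*} [DiffeologicalSpace X]
    [DiffeologicalSpace Y] : DiffeologicalSpace (SmoothMap X Y) where
  plots n := {p | DSmooth fun z : EuclideanSpace ℝ (Fin n) × X => p z.1 z.2}
  constant_plots {n} f := fun m r hr => f.2 m _ (isPlot_prod_iff.1 hr).2
  plot_reparam {n m p f} hp hf := fun k r hr =>
    hp k (fun y => (f (r y).1, (r y).2)) (isPlot_prod_iff.2
      ⟨(hf.comp (isPlot_prod_iff.1 hr).1.contDiff).isPlot, (isPlot_prod_iff.1 hr).2⟩)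
  locality {n p} hp := fun m r hr => DiffeologicalSpace.locality fun y => by
    obtain ⟨u, hu, hyu, h⟩ := hp (r y).1
    have h1 : ContDiff ℝ ∞ fun y => (r y).1 := (isPlot_prod_iff.1 hr).1.contDiff
    refine ⟨(fun y => (r y).1) ⁻¹' u, hu.preimage h1.continuous, hyu, fun {k g} hg hg' => ?_⟩
    exact h (f := fun x => (r (g x)).1) hg (h1.comp hg') k (fun x => (x, (r (g x)).2))
      (isPlot_prod_iff.2 ⟨isPlot_id', isPlot_reparam (isPlot_prod_iff.1 hr).2 hg'⟩)

/-! ### Diffeological vector spaces -/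

/-- A real vector space with a diffeology such that addition and scalar multiplication are
smooth. -/
class DiffeologicalVectorSpace (V : Type*) [AddCommGroup V] [Module ℝ V]
    [DiffeologicalSpace V] : Prop where
  dSmooth_add : DSmooth fun v : V × V => v.1 + v.2
  dSmooth_smul : DSmooth fun v : ℝ × V => v.1 • v.2

theorem isPlot_add {V : Type*} [AddCommGroup V] [Module ℝ V] [DiffeologicalSpace V]
    [DiffeologicalVectorSpace V] {n : ℕ} {p q : EuclideanSpace ℝ (Fin n) → V}
    (hp : IsPlot p) (hq : IsPlot q) : IsPlot (fun x => p x + q x) :=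
  DiffeologicalVectorSpace.dSmooth_add n (fun x => (p x, q x)) (isPlot_prod_iff.2 ⟨hp, hq⟩)

theorem isPlot_smul {V : Type*} [AddCommGroup V] [Module ℝ V] [DiffeologicalSpace V]
    [DiffeologicalVectorSpace V] {n : ℕ} {c : EuclideanSpace ℝ (Fin n) → ℝ}
    {q : EuclideanSpace ℝ (Fin n) → V}
    (hc : IsPlot c) (hq : IsPlot q) : IsPlot (fun x => c x • q x) :=
  DiffeologicalVectorSpace.dSmooth_smul n (fun x => (c x, q x)) (isPlot_prod_iff.2 ⟨hc, hq⟩)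

instance instDVSReal : DiffeologicalVectorSpace ℝ where
  dSmooth_add _ _ hr :=
    ((isPlot_prod_iff.1 hr).1.contDiff.add (isPlot_prod_iff.1 hr).2.contDiff).isPlot
  dSmooth_smul _ _ hr :=
    ((isPlot_prod_iff.1 hr).1.contDiff.smul (isPlot_prod_iff.1 hr).2.contDiff).isPlot

instance instDVSProd {V W : Type*} [AddCommGroup V] [Module ℝ V] [DiffeologicalSpace V]
    [DiffeologicalVectorSpace V] [AddCommGroup W] [Module ℝ W] [DiffeologicalSpace W]
    [DiffeologicalVectorSpace W] : DiffeologicalVectorSpace (V × W) where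
  dSmooth_add _ _ hr := isPlot_prod_iff.2
    ⟨isPlot_add (isPlot_prod_iff.1 (isPlot_prod_iff.1 hr).1).1
      (isPlot_prod_iff.1 (isPlot_prod_iff.1 hr).2).1,
     isPlot_add (isPlot_prod_iff.1 (isPlot_prod_iff.1 hr).1).2
      (isPlot_prod_iff.1 (isPlot_prod_iff.1 hr).2).2⟩
  dSmooth_smul _ _ hr := isPlot_prod_iff.2
    ⟨isPlot_smul (isPlot_prod_iff.1 hr).1 (isPlot_prod_iff.1 (isPlot_prod_iff.1 hr).2).1,
     isPlot_smul (isPlot_prod_iff.1 hr).1 (isPlot_prod_iff.1 (isPlot_prod_iff.1 hr).2).2⟩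

instance instDVSPi {ι : Type*} {V : ι → Type*} [∀ i, AddCommGroup (V i)] [∀ i, Module ℝ (V i)]
    [∀ i, DiffeologicalSpace (V i)] [∀ i, DiffeologicalVectorSpace (V i)] :
    DiffeologicalVectorSpace (∀ i, V i) where
  dSmooth_add _ _ hr := isPlot_pi_iff.2 fun i =>
    isPlot_add (isPlot_pi_iff.1 (isPlot_prod_iff.1 hr).1 i)
      (isPlot_pi_iff.1 (isPlot_prod_iff.1 hr).2 i)
  dSmooth_smul _ _ hr := isPlot_pi_iff.2 fun i =>
    isPlot_smul (isPlot_prod_iff.1 hr).1 (isPlot_pi_iff.1 (isPlot_prod_iff.1 hr).2 i)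

/-- A linear subspace carries the sub-diffeology. -/
instance instDiffeologicalSpaceSubmodule {V : Type*} [AddCommGroup V] [Module ℝ V]
    [d : DiffeologicalSpace V] (S : Submodule ℝ V) : DiffeologicalSpace S :=
  induced (fun s : S => (s : V)) d

instance instDVSSubmodule {V : Type*} [AddCommGroup V] [Module ℝ V] [DiffeologicalSpace V]
    [DiffeologicalVectorSpace V] (S : Submodule ℝ V) : DiffeologicalVectorSpace S where
  dSmooth_add _ r hr := isPlot_add (p := fun x => ((r x).1 : V)) (q := fun x => ((r x).2 : V))
    (isPlot_prod_iff.1 hr).1 (isPlot_prod_iff.1 hr).2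
  dSmooth_smul _ r hr := isPlot_smul (q := fun x => ((r x).2 : V))
    (isPlot_prod_iff.1 hr).1 (isPlot_prod_iff.1 hr).2

/-- A quotient vector space carries the quotient diffeology. -/
instance instDiffeologicalSpaceQuotient {V : Type*} [AddCommGroup V] [Module ℝ V]
    [d : DiffeologicalSpace V] (S : Submodule ℝ V) : DiffeologicalSpace (V ⧸ S) :=
  coinduced (fun v : V => (Submodule.Quotient.mk v : V ⧸ S)) d

/-- A smooth map of a Euclidean space into a given neighbourhood of `x` that is the identity
near `x`. -/
theorem exists_contDiff_retract {n : ℕ} {u : Set (EuclideanSpace ℝ (Fin n))} (hu : IsOpen u)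
    {x : EuclideanSpace ℝ (Fin n)} (hx : x ∈ u) :
    ∃ h : EuclideanSpace ℝ (Fin n) → EuclideanSpace ℝ (Fin n), ContDiff ℝ ∞ h ∧ (∀ y, h y ∈ u) ∧
      ∃ v : Set (EuclideanSpace ℝ (Fin n)), IsOpen v ∧ x ∈ v ∧ ∀ y ∈ v, h y = y := by
  obtain ⟨ε, hε, hεu⟩ := Metric.isOpen_iff.1 hu x hx
  let b : ContDiffBump x := ⟨ε / 2, ε, by positivity, by linarith⟩
  refine ⟨fun y => x + b y • (y - x), contDiff_const.add (b.contDiff.smul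
    (contDiff_id.sub contDiff_const)), fun y => hεu ?_, Metric.ball x (ε / 2), Metric.isOpen_ball,
    Metric.mem_ball_self (by positivity), fun y hy => ?_⟩
  · rw [Metric.mem_ball, dist_eq_norm, add_sub_cancel_left, norm_smul, Real.norm_eq_abs,
      abs_of_nonneg b.nonneg]
    by_cases h : ε ≤ dist y x
    · rw [b.zero_of_le_dist h]
      simpa using hε
    · push Not at h
      rw [dist_eq_norm] at h
      exact lt_of_le_of_lt (mul_le_of_le_one_left (norm_nonneg _) b.le_one) h
  · have : b y = 1 := b.one_of_mem_closedBall (Metric.ball_subset_closedBall hy)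
    simp [this]

/-- The plots of the pushforward diffeology along a surjection are the maps that locally lift
to plots. -/
theorem isPlot_coinduced_iff {X Y : Type*} [d : DiffeologicalSpace X] {f : X → Y}
    (hf : Function.Surjective f) {n : ℕ} {p : EuclideanSpace ℝ (Fin n) → Y} :
    @IsPlot Y (coinduced f d) n p ↔ ∀ x, ∃ u : Set (EuclideanSpace ℝ (Fin n)), IsOpen u ∧ x ∈ u ∧
      ∃ q : EuclideanSpace ℝ (Fin n) → X, IsPlot q ∧ ∀ y ∈ u, f (q y) = p y := by
  constructor
  · let L : DiffeologicalSpace Y :=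
      { plots n := {p | ∀ x, ∃ u : Set (EuclideanSpace ℝ (Fin n)), IsOpen u ∧ x ∈ u ∧
          ∃ q : EuclideanSpace ℝ (Fin n) → X, IsPlot q ∧ ∀ y ∈ u, f (q y) = p y}
        constant_plots y x := by
          obtain ⟨z, rfl⟩ := hf y
          exact ⟨Set.univ, isOpen_univ, trivial, fun _ => z, isPlot_const, fun _ _ => rfl⟩
        plot_reparam {n m p g} hp hg x := by
          obtain ⟨u, hu, hxu, q, hq, h⟩ := hp (g x)
          exact ⟨g ⁻¹' u, hu.preimage hg.continuous, hxu, q ∘ g, isPlot_reparam hq hg,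
            fun y hy => h _ hy⟩
        locality {n p} hp x := by
          obtain ⟨u, hu, hxu, h⟩ := hp x
          obtain ⟨g, hg, hgu, v, hv, hxv, hgv⟩ := exists_contDiff_retract hu hxu
          obtain ⟨w, hw, hxw, q, hq, hqw⟩ := h hgu hg x
          refine ⟨v ∩ w, hv.inter hw, ⟨hxv, hxw⟩, q, hq, fun y hy => ?_⟩
          rw [hqw y hy.2, Function.comp_apply, hgv y hy.1] }
    have hL : coinduced f d ≤ L := by
      refine DiffeologicalSpace.generateFrom_le_iff.2 ?_
      rintro n p ⟨q, hq, h⟩ x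
      exact ⟨Set.univ, isOpen_univ, trivial, q, hq, fun y _ => (congrFun h y).symm⟩
    intro hp
    exact DiffeologicalSpace.le_iff'.1 hL n p hp
  · intro h
    refine (coinduced f d).locality fun x => ?_
    obtain ⟨u, hu, hxu, q, hq, h⟩ := h x
    refine ⟨u, hu, hxu, fun {m g} hg hg' => ?_⟩
    refine DiffeologicalSpace.isPlot_generatedFrom_of_mem
      ⟨q ∘ g, isPlot_reparam hq hg', ?_⟩
    funext y
    exact (h (g y) (hg y)).symm

instance instDVSQuotient {V : Type*} [AddCommGroup V] [Module ℝ V] [DiffeologicalSpace V]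
    [DiffeologicalVectorSpace V] (S : Submodule ℝ V) : DiffeologicalVectorSpace (V ⧸ S) where
  dSmooth_add n r hr := by
    have hs := Submodule.Quotient.mk_surjective S
    refine (isPlot_coinduced_iff hs).2 fun x => ?_
    obtain ⟨u, hu, hxu, q, hq, h⟩ := (isPlot_coinduced_iff hs).1 (isPlot_prod_iff.1 hr).1 x
    obtain ⟨u', hu', hxu', q', hq', h'⟩ := (isPlot_coinduced_iff hs).1 (isPlot_prod_iff.1 hr).2 x
    refine ⟨u ∩ u', hu.inter hu', ⟨hxu, hxu'⟩, _, isPlot_add hq hq', fun y hy => ?_⟩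
    rw [Submodule.Quotient.mk_add, h y hy.1, h' y hy.2]
    rfl
  dSmooth_smul n r hr := by
    have hs := Submodule.Quotient.mk_surjective S
    refine (isPlot_coinduced_iff hs).2 fun x => ?_
    obtain ⟨u, hu, hxu, q, hq, h⟩ := (isPlot_coinduced_iff hs).1 (isPlot_prod_iff.1 hr).2 x
    refine ⟨u, hu, hxu, _, isPlot_smul (isPlot_prod_iff.1 hr).1 hq, fun y hy => ?_⟩
    rw [Submodule.Quotient.mk_smul, h y hy]
    rfl

/-- The smooth maps as a linear subspace of all maps; used only to give `SmoothMap X V` its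
pointwise vector space structure. -/
def smoothSubmodule (X V : Type*) [DiffeologicalSpace X] [AddCommGroup V] [Module ℝ V]
    [DiffeologicalSpace V] [DiffeologicalVectorSpace V] : Submodule ℝ (X → V) where
  carrier := {f | DSmooth f}
  add_mem' hf hg := fun n p hp => isPlot_add (hf n p hp) (hg n p hp)
  zero_mem' := fun _ _ _ => isPlot_const
  smul_mem' c _ hf := fun n p hp => isPlot_smul (isPlot_const (x := c)) (hf n p hp)

instance instAddCommGroupSmoothMap {X V : Type*} [DiffeologicalSpace X] [AddCommGroup V]
    [Module ℝ V] [DiffeologicalSpace V] [DiffeologicalVectorSpace V] :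
    AddCommGroup (SmoothMap X V) :=
  inferInstanceAs (AddCommGroup (smoothSubmodule X V))

instance instModuleSmoothMap {X V : Type*} [DiffeologicalSpace X] [AddCommGroup V]
    [Module ℝ V] [DiffeologicalSpace V] [DiffeologicalVectorSpace V] :
    Module ℝ (SmoothMap X V) :=
  inferInstanceAs (Module ℝ (smoothSubmodule X V))

theorem SmoothMap.coe_add {X V : Type*} [DiffeologicalSpace X] [AddCommGroup V]
    [Module ℝ V] [DiffeologicalSpace V] [DiffeologicalVectorSpace V] (f g : SmoothMap X V) :
    ⇑(f + g) = ⇑f + ⇑g := rfl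

theorem SmoothMap.coe_smul {X V : Type*} [DiffeologicalSpace X] [AddCommGroup V]
    [Module ℝ V] [DiffeologicalSpace V] [DiffeologicalVectorSpace V] (c : ℝ) (f : SmoothMap X V) :
    ⇑(c • f) = c • ⇑f := rfl

instance instDVSSmoothMap {X V : Type*} [DiffeologicalSpace X] [AddCommGroup V]
    [Module ℝ V] [DiffeologicalSpace V] [DiffeologicalVectorSpace V] :
    DiffeologicalVectorSpace (SmoothMap X V) where
  dSmooth_add _ _ hr := fun k s hs =>
    isPlot_add ((isPlot_prod_iff.1 hr).1 k s hs) ((isPlot_prod_iff.1 hr).2 k s hs)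
  dSmooth_smul _ _ hr := fun k s hs =>
    isPlot_smul (isPlot_reparam (isPlot_prod_iff.1 hr).1 (isPlot_prod_iff.1 hs).1.contDiff)
      ((isPlot_prod_iff.1 hr).2 k s hs)

/-! ### Short exact sequences of diffeological vector spaces -/

/-- `0 → A → V → B → 0` is a short exact sequence of diffeological vector spaces: `i` and `p` are
smooth linear maps forming a short exact sequence of vector spaces, `i` is an induction and `p`
is a subduction. -/
structure IsShortExact {A V B : Type*} [AddCommGroup A] [Module ℝ A] [DiffeologicalSpace A]
    [DiffeologicalVectorSpace A] [AddCommGroup V] [Module ℝ V] [DiffeologicalSpace V]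
    [DiffeologicalVectorSpace V] [AddCommGroup B] [Module ℝ B] [DiffeologicalSpace B]
    [DiffeologicalVectorSpace B] (i : A →ₗ[ℝ] V) (p : V →ₗ[ℝ] B) : Prop where
  dSmooth_left : DSmooth i
  dSmooth_right : DSmooth p
  injective : Function.Injective i
  exact : Function.Exact i p
  surjective : Function.Surjective p
  isInduction : IsInduction i
  isSubduction : IsSubduction p

/-- The sequence `0 → A → V → B → 0` splits smoothly: by an isomorphism of diffeological vector
spaces `V ≅ A × B` it is isomorphic, with identities on `A` and `B`, to the sequence
`0 → A → A × B → B → 0`. -/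
def SplitsSmoothly {A V B : Type*} [AddCommGroup A] [Module ℝ A] [DiffeologicalSpace A]
    [DiffeologicalVectorSpace A] [AddCommGroup V] [Module ℝ V] [DiffeologicalSpace V]
    [DiffeologicalVectorSpace V] [AddCommGroup B] [Module ℝ B] [DiffeologicalSpace B]
    [DiffeologicalVectorSpace B] (i : A →ₗ[ℝ] V) (p : V →ₗ[ℝ] B) : Prop :=
  ∃ e : V ≃ₗ[ℝ] A × B, DSmooth e ∧ DSmooth e.symm ∧
    (∀ a, e (i a) = (a, 0)) ∧ ∀ v, (e v).2 = p v

/-! ### The Taylor map -/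

theorem SmoothMap.contDiff (f : SmoothMap ℝ ℝ) : ContDiff ℝ ∞ f :=
  DSmooth.contDiff f.2

/-- The Taylor map `f ↦ (f^(n)(0))_n` from `C^∞(ℝ, ℝ)` to the product of countably many copies
of `ℝ`. -/
def taylorMap : SmoothMap ℝ ℝ →ₗ[ℝ] (ℕ → ℝ) where
  toFun f n := iteratedDeriv n f 0
  map_add' f g := by
    funext n
    rw [SmoothMap.coe_add, Pi.add_apply]
    exact iteratedDeriv_add (f.contDiff.of_le (by exact_mod_cast le_top)).contDiffAt
      (g.contDiff.of_le (by exact_mod_cast le_top)).contDiffAt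
  map_smul' c f := by
    funext n
    rw [SmoothMap.coe_smul, RingHom.id_apply, Pi.smul_apply]
    exact iteratedDeriv_const_smul (f.contDiff.of_le (by exact_mod_cast le_top)).contDiffAt c

/-- The subspace `K` of the smooth functions on `ℝ` all of whose derivatives vanish at `0`. -/
def flatFunctions : Submodule ℝ (SmoothMap ℝ ℝ) where
  carrier := {f | ∀ n : ℕ, iteratedDeriv n f 0 = 0}
  add_mem' {f g} hf hg n := by
    have h := congrFun (taylorMap.map_add f g) n
    exact h.trans (by rw [Pi.add_apply]; exact (congrArg₂ (· + ·) (hf n) (hg n)).trans (add_zero 0))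
  zero_mem' n := congrFun taylorMap.map_zero n
  smul_mem' c f hf n := by
    have h := congrFun (taylorMap.map_smul c f) n
    exact h.trans (by rw [Pi.smul_apply]; exact (congrArg (c • ·) (hf n)).trans (smul_zero c))

end Diffeology

end

/-! Everything rests on two constructions: Borel's theorem with smooth parameters, and smooth curves
in `ℕ → ℝ` assembled from bump functions. For Borel, sum `G k x * h k y`, where `h k` has the germ
of `y ^ k / k!` at `0` and is rescaled so that all derivatives of the `k`-th term of order below `k`
are at most `2⁻ᵏ`. The series then converges with all derivatives, and the germs give the prescribed
Taylor coefficients. Cutoffs reduce coefficients on an open set to compactly supported ones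
(`exists_contDiffOn_iteratedDeriv_eq`). A plot of `C^∞(ℝ, ℝ)` is a jointly smooth function, so this
theorem says exactly that plots of the product lift along `taylorMap`: it is a subduction, and the
quotient isomorphism follows formally. A curve in the product is smooth as soon as each coordinate
is. Such curves pass through fast converging sequences, which determines the D-topology. They may
also have arbitrarily large coefficients in successive coordinates; a smooth section would turn such
a curve into a continuous function unbounded on a compact rectangle. A smooth retraction onto `K`
would produce a section, so the sequence cannot split. -/

/-! ### Partial derivatives and derivative bounds on products -/

theorem iteratedDeriv_curry_right {E : Type*} [NormedAddCommGroup E] [NormedSpace ℝ E]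
    {g : E × ℝ → ℝ} (hg : ContDiff ℝ ∞ g) (k : ℕ) (x : E) (y : ℝ) :
    iteratedDeriv k (fun t => g (x, t)) y = iteratedFDeriv ℝ k g (x, y) fun _ => (0, 1) := by
  -- The affine map `t ↦ (x, t)` is split into a translation and the linear map `inr`, each with its
  -- own chain rule.
  have h : (fun t => g (x, t)) =
      (fun z => g ((x, 0) + z)) ∘ ContinuousLinearMap.inr ℝ E ℝ := by
    funext t
    simp
  have hs : ContDiff ℝ ∞ fun z => g ((x, 0) + z) := hg.comp (contDiff_const.add contDiff_id)
  rw [iteratedDeriv_eq_iteratedFDeriv, h,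
    ContinuousLinearMap.iteratedFDeriv_comp_right _ hs y (by exact_mod_cast le_top),
    iteratedFDeriv_comp_add_left]
  simp

theorem contDiff_iteratedDeriv_curry_right {E : Type*} [NormedAddCommGroup E] [NormedSpace ℝ E]
    {g : E × ℝ → ℝ} (hg : ContDiff ℝ ∞ g) (k : ℕ) (y : ℝ) :
    ContDiff ℝ ∞ fun x => iteratedDeriv k (fun t => g (x, t)) y := by
  simp_rw [iteratedDeriv_curry_right hg]
  have h : ContDiff ℝ ∞ (iteratedFDeriv ℝ k g) := hg.iteratedFDeriv_right (m := ∞) (by exact_mod_cast le_rfl)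
  exact (ContinuousMultilinearMap.apply ℝ (fun _ : Fin k => E × ℝ) ℝ
    fun _ => (0, 1)).contDiff.comp (h.comp (contDiff_id.prodMk contDiff_const))

theorem exists_bound_iteratedFDeriv {E : Type*} [NormedAddCommGroup E] [NormedSpace ℝ E]
    {f : E → ℝ} (hf : ContDiff ℝ ∞ f) (hc : HasCompactSupport f) :
    ∃ C : ℕ → ℝ, ∀ i x, ‖iteratedFDeriv ℝ i f x‖ ≤ C i := by
  choose C hC using fun i : ℕ => (hf.continuous_iteratedFDeriv
    (m := i) (by exact_mod_cast le_top)).bounded_above_of_compact_support (hc.iteratedFDeriv i)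
  exact ⟨C, hC⟩

theorem norm_iteratedFDeriv_comp_le_of_norm_le_one {E F : Type*} [NormedAddCommGroup E]
    [NormedSpace ℝ E] [NormedAddCommGroup F] [NormedSpace ℝ F] {f : F → ℝ}
    (hf : ContDiff ℝ ∞ f) (L : E →L[ℝ] F) (hL : ‖L‖ ≤ 1) (i : ℕ) (x : E) :
    ‖iteratedFDeriv ℝ i (fun z => f (L z)) x‖ ≤ ‖iteratedFDeriv ℝ i f (L x)‖ := by
  have h := L.iteratedFDeriv_comp_right hf x (i := i) (by exact_mod_cast le_top)
  rw [show (fun z => f (L z)) = f ∘ L from rfl, h]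
  refine (ContinuousMultilinearMap.norm_compContinuousLinearMap_le _ _).trans ?_
  refine mul_le_of_le_one_right (norm_nonneg _) ?_
  exact Finset.prod_le_one (fun _ _ => norm_nonneg _) fun _ _ => hL

/-- Leibniz's rule; the two projections have norm at most `1`, so composing with them costs nothing.
-/
theorem norm_iteratedFDeriv_prod_mul_le {E F : Type*} [NormedAddCommGroup E] [NormedSpace ℝ E]
    [NormedAddCommGroup F] [NormedSpace ℝ F] {f : E → ℝ} {h : F → ℝ} (hf : ContDiff ℝ ∞ f)
    (hh : ContDiff ℝ ∞ h) {A B : ℕ → ℝ} {n : ℕ} (hA : ∀ i ≤ n, ∀ x, ‖iteratedFDeriv ℝ i f x‖ ≤ A i)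
    (hB : ∀ i ≤ n, ∀ x, ‖iteratedFDeriv ℝ i h x‖ ≤ B i) (z : E × F) :
    ‖iteratedFDeriv ℝ n (fun z : E × F => f z.1 * h z.2) z‖ ≤
      ∑ i ∈ Finset.range (n + 1), (n.choose i : ℝ) * A i * B (n - i) := by
  refine (norm_iteratedFDeriv_mul_le (hf.comp contDiff_fst) (hh.comp contDiff_snd) z
    (by exact_mod_cast le_top)).trans (Finset.sum_le_sum fun i hi => ?_)
  have hi : i ≤ n := Nat.lt_succ_iff.1 (Finset.mem_range.1 hi)
  have h1 : ‖iteratedFDeriv ℝ i (f ∘ Prod.fst : E × F → ℝ) z‖ ≤ A i :=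
    (norm_iteratedFDeriv_comp_le_of_norm_le_one hf (.fst ℝ E F) (ContinuousLinearMap.norm_fst_le ..)
      i z).trans (hA i hi _)
  have h2 : ‖iteratedFDeriv ℝ (n - i) (h ∘ Prod.snd : E × F → ℝ) z‖ ≤ B (n - i) :=
    (norm_iteratedFDeriv_comp_le_of_norm_le_one hh (.snd ℝ E F) (ContinuousLinearMap.norm_snd_le ..)
      _ z).trans (hB _ (Nat.sub_le _ _) _)
  have h3 := (norm_nonneg _).trans h1
  gcongr

/-! ### Borel's theorem with parameters -/

/-- A compactly supported function with the germ of `y ^ k / k!` at `0` whose derivatives of order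
less than `k` are small. -/
theorem exists_small_monomial_germ (k : ℕ) :
    ∃ B : ℕ → ℝ, ∀ δ : ℝ, 0 < δ → ∃ h : ℝ → ℝ, ContDiff ℝ ∞ h ∧ HasCompactSupport h ∧
      (h =ᶠ[nhds 0] fun y => (k.factorial : ℝ)⁻¹ * y ^ k) ∧
      ∀ j < k, ∀ y, ‖iteratedFDeriv ℝ j h y‖ ≤ δ * B j := by
  let χ : ContDiffBump (0 : ℝ) := ⟨1, 2, one_pos, one_lt_two⟩
  let H : ℝ → ℝ := fun t => χ t * ((k.factorial : ℝ)⁻¹ * t ^ k)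
  have hH : ContDiff ℝ ∞ H := χ.contDiff.mul (contDiff_const.mul (contDiff_id.pow k))
  have hHc : HasCompactSupport H := χ.hasCompactSupport.mul_right
  obtain ⟨B, hB⟩ := exists_bound_iteratedFDeriv hH hHc
  refine ⟨B, fun δ hδ => ?_⟩
  -- For `h y = l⁻ᵏ H (l y)` the `j`-th derivative carries the factor `l ^ (j - k)`, which for `j <
  -- k` and `l ≥ 1` is at most `l⁻¹ ≤ δ`. The germ at `0` does not change, and `B` does not depend
  -- on `δ`.
  let l : ℝ := max 1 δ⁻¹
  have hl : 1 ≤ l := le_max_left _ _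
  have hl0 : 0 < l := one_pos.trans_le hl
  have hlδ : l⁻¹ ≤ δ := inv_le_of_inv_le₀ hδ (le_max_right _ _)
  have hHl : ContDiff ℝ ∞ fun y => H (l * y) := hH.comp (contDiff_const.mul contDiff_id)
  refine ⟨fun y => (l ^ k)⁻¹ * H (l * y), contDiff_const.mul hHl, ?_, ?_, fun j hj y => ?_⟩
  · exact HasCompactSupport.mul_left
      (hHc.comp_homeomorph (Homeomorph.mulLeft₀ l hl0.ne'))
  · have : Filter.Tendsto (fun y : ℝ => l * y) (nhds 0) (nhds 0) := by
      simpa using (continuous_const_mul l).tendsto 0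
    filter_upwards [this.eventually χ.eventuallyEq_one] with y hy
    simp only [H, hy, Pi.one_apply, one_mul, mul_pow]
    field_simp
  · rw [norm_iteratedFDeriv_eq_norm_iteratedDeriv, iteratedDeriv_const_mul_field,
      iteratedDeriv_comp_const_mul (hH.of_le (by exact_mod_cast le_top))]
    have h1 : ‖iteratedDeriv j H (l * y)‖ ≤ B j := by
      rw [← norm_iteratedFDeriv_eq_norm_iteratedDeriv]
      exact hB j _
    have h2 : (l ^ k)⁻¹ * l ^ j ≤ δ := by
      refine le_trans ?_ hlδ
      rw [inv_mul_le_iff₀ (by positivity), ← div_eq_mul_inv, le_div_iff₀ hl0, ← pow_succ]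
      exact pow_le_pow_right₀ hl hj
    rw [← mul_assoc, norm_mul, Real.norm_of_nonneg (by positivity)]
    gcongr

/-- The bounds needed to sum the series of the Borel construction. -/
theorem exists_monomial_germ_mul_bound {E : Type*} [NormedAddCommGroup E] [NormedSpace ℝ E]
    {G : E → ℝ} (hG : ContDiff ℝ ∞ G) (hc : HasCompactSupport G) (k : ℕ) {ε : ℝ} (hε : 0 < ε) :
    ∃ h : ℝ → ℝ, ContDiff ℝ ∞ h ∧ (h =ᶠ[nhds 0] fun y => (k.factorial : ℝ)⁻¹ * y ^ k) ∧
      ∃ C : ℕ → ℝ, (∀ j < k, C j = ε) ∧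
        ∀ j z, ‖iteratedFDeriv ℝ j (fun z : E × ℝ => G z.1 * h z.2) z‖ ≤ C j := by
  obtain ⟨A, hA⟩ := exists_bound_iteratedFDeriv hG hc
  obtain ⟨B, hB⟩ := exists_small_monomial_germ k
  let M : ℕ → ℝ := fun j => ∑ i ∈ Finset.range (j + 1), (j.choose i : ℝ) * A i * B (j - i)
  -- `M j` is the Leibniz bound at `δ = 1`, and `N` dominates `M j` for all `j < k`, so `δ = ε / N`
  -- brings these bounds below `ε`. Orders `j ≥ k` only need some finite bound.
  let N : ℝ := 1 + ∑ j ∈ Finset.range k, |M j|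
  have hN : 0 < N := by positivity
  obtain ⟨h, hh, hhc, hhg, hhB⟩ := hB (ε / N) (by positivity)
  obtain ⟨D, hD⟩ := exists_bound_iteratedFDeriv hh hhc
  refine ⟨h, hh, hhg, fun j => if j < k then ε else
    ∑ i ∈ Finset.range (j + 1), (j.choose i : ℝ) * A i * D (j - i), fun j hj => if_pos hj,
    fun j z => ?_⟩
  dsimp only
  split_ifs with hj
  · refine (norm_iteratedFDeriv_prod_mul_le hG hh (A := A) (B := fun i => ε / N * B i)
      (fun i _ => hA i) (fun i hi => hhB i (hi.trans_lt hj)) z).trans ?_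
    have h1 : ∑ i ∈ Finset.range (j + 1), (j.choose i : ℝ) * A i * (ε / N * B (j - i)) =
        ε / N * M j := by
      rw [Finset.mul_sum]
      exact Finset.sum_congr rfl fun i _ => by ring
    have h2 : M j ≤ N := by
      refine (le_abs_self _).trans ((Finset.single_le_sum (f := fun j => |M j|)
        (fun i _ => abs_nonneg _) (Finset.mem_range.2 hj)).trans ?_)
      exact le_add_of_nonneg_left zero_le_one
    rw [h1, div_mul_eq_mul_div, div_le_iff₀ hN]
    gcongr
  · exact norm_iteratedFDeriv_prod_mul_le hG hh (fun i _ => hA i) (fun i _ => hD i) z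

theorem iteratedDeriv_monomial_germ {h : ℝ → ℝ} {k : ℕ}
    (hh : h =ᶠ[nhds 0] fun y => (k.factorial : ℝ)⁻¹ * y ^ k) (n : ℕ) :
    iteratedDeriv n h 0 = if n = k then 1 else 0 := by
  rw [hh.iteratedDeriv_eq, iteratedDeriv_const_mul_field, iteratedDeriv_fun_pow_zero]
  split_ifs
  · exact inv_mul_cancel₀ (by positivity)
  · simp

/-- Borel's theorem with parameters, for compactly supported coefficients. -/
theorem exists_monomial_germs_summable {E : Type*} [NormedAddCommGroup E] [NormedSpace ℝ E]
    {G : ℕ → E → ℝ} (hG : ∀ k, ContDiff ℝ ∞ (G k)) (hc : ∀ k, HasCompactSupport (G k)) :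
    ∃ h : ℕ → ℝ → ℝ, (∀ k, ContDiff ℝ ∞ (h k)) ∧
      (∀ k, h k =ᶠ[nhds 0] fun y => (k.factorial : ℝ)⁻¹ * y ^ k) ∧
      (∀ z : E × ℝ, Summable fun k => G k z.1 * h k z.2) ∧
      (ContDiff ℝ ∞ fun z : E × ℝ => ∑' k, G k z.1 * h k z.2) ∧
      ∀ k x, iteratedDeriv k (fun y => ∑' l, G l x * h l y) 0 = G k x := by
  choose h hh hg C hC hb using fun k =>
    exists_monomial_germ_mul_bound (hG k) (hc k) k (ε := (1 / 2) ^ k) (by positivity)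
  have hs : ∀ j, Summable fun k => C k j := fun j => by
    -- `C k j` is known to be `2⁻ᵏ` only for `k > j`, so the first `j + 1` terms are dropped.
    rw [← summable_nat_add_iff (j + 1)]
    refine ((summable_nat_add_iff (j + 1)).2 summable_geometric_two).congr fun k => ?_
    exact (hC _ j (by omega)).symm
  have ht : ∀ k, ContDiff ℝ ∞ fun z : E × ℝ => G k z.1 * h k z.2 := fun k =>
    ((hG k).comp contDiff_fst).mul ((hh k).comp contDiff_snd)
  have hsum : ContDiff ℝ ∞ fun z : E × ℝ => ∑' k, G k z.1 * h k z.2 :=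
    contDiff_tsum ht (fun j _ => hs j) fun j k z _ => hb k j z
  refine ⟨h, hh, hg, fun z => .of_norm_bounded (hs 0) fun k => ?_, hsum, fun k x => ?_⟩
  · simpa using hb k 0 z
  · have hsk : Summable fun l => iteratedFDeriv ℝ k (fun z : E × ℝ => G l z.1 * h l z.2) (x, 0) :=
      .of_norm_bounded (hs k) fun l => hb l k _
    rw [iteratedDeriv_curry_right hsum k x 0, iteratedFDeriv_tsum_apply ht (fun j _ => hs j)
      (fun j k z _ => hb k j z) (mod_cast le_top)]
    -- Evaluation at the vectors `(0, 1)` is continuous and linear, hence passes through the sum;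
    -- this recovers the derivatives in `y` term by term.
    have hev := (ContinuousMultilinearMap.apply ℝ (fun _ : Fin k => E × ℝ) ℝ
      fun _ => ((0 : E), (1 : ℝ))).map_tsum hsk
    simp only [ContinuousMultilinearMap.apply_apply] at hev
    rw [hev]
    simp_rw [← iteratedDeriv_curry_right (ht _), iteratedDeriv_const_mul_field,
      iteratedDeriv_monomial_germ (hg _)]
    simp

open Topology Set in
/-- Compactly supported smooth cutoffs in an open set that are locally eventually equal to `1`. -/
theorem exists_smooth_cutoffs {E : Type*} [NormedAddCommGroup E] [NormedSpace ℝ E]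
    [FiniteDimensional ℝ E] {U : Set E} (hU : IsOpen U) :
    ∃ b : ℕ → E → ℝ, (∀ k, ContDiff ℝ ∞ (b k)) ∧ (∀ k, HasCompactSupport (b k)) ∧
      (∀ k, tsupport (b k) ⊆ U) ∧
      ∀ x ∈ U, ∃ j, ∀ᶠ y in 𝓝 x, ∀ k ≥ j, b k y = 1 := by
  have := hU.locallyCompactSpace
  -- Take `b k = 1` on `K k`. A point of `U` has some `K j` as a neighbourhood, and `K j ⊆ K k` for
  -- `k ≥ j`.
  let K := CompactExhaustion.choice U
  have hb : ∀ k, ∃ b : E → ℝ, ContDiff ℝ ∞ b ∧ HasCompactSupport b ∧ tsupport b ⊆ U ∧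
      ∀ y ∈ K k, b y = 1 := fun k => by
    have hK : IsCompact ((↑) '' K k : Set E) := (K.isCompact k).image continuous_subtype_val
    obtain ⟨t, ht, hKt, htU⟩ := exists_compact_between hK hU (by simp)
    obtain ⟨f, hf1, hf0, -⟩ := exists_contMDiffMap_one_nhds_of_subset_interior (n := ⊤)
      (modelWithCornersSelf ℝ E) hK.isClosed hKt
    have hts : tsupport f ⊆ t := closure_minimal (fun x hx => by
      by_contra h
      exact hx (hf0 x h)) ht.isClosed
    exact ⟨f, f.contMDiff.contDiff, ht.of_isClosed_subset (isClosed_tsupport _) hts,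
      hts.trans htU, fun y hy => hf1.self_of_nhdsSet _ (mem_image_of_mem _ hy)⟩
  choose b hb hbc hbU hb1 using hb
  refine ⟨b, hb, hbc, hbU, fun x hx => ?_⟩
  obtain ⟨j, hj⟩ := K.exists_mem_nhds ⟨x, hx⟩
  refine ⟨j, ?_⟩
  have : (↑) '' K j ∈ 𝓝 x := hU.isOpenMap_subtype_val.image_mem_nhds hj
  filter_upwards [this] with y hy k hk
  obtain ⟨y, hy, rfl⟩ := hy
  exact hb1 k y (K.subset hk hy)

open Topology Set in
/-- Borel's theorem with parameters in an open set. -/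
theorem exists_contDiffOn_iteratedDeriv_eq {E : Type*} [NormedAddCommGroup E] [NormedSpace ℝ E]
    [FiniteDimensional ℝ E] {U : Set E} (hU : IsOpen U) {F : ℕ → E → ℝ}
    (hF : ∀ k, ContDiffOn ℝ ∞ (F k) U) :
    ∃ d : E × ℝ → ℝ, ContDiffOn ℝ ∞ d (U ×ˢ univ) ∧
      ∀ k : ℕ, ∀ x ∈ U, iteratedDeriv k (fun y : ℝ => d (x, y)) 0 = F k x := by
  obtain ⟨b, hb, hbc, hbU, hb1⟩ := exists_smooth_cutoffs hU
  have hG : ∀ k, ContDiff ℝ ∞ fun x => b k x * F k x := fun k =>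
    contDiff_iff_contDiffAt.2 fun x => by
      by_cases hx : x ∈ tsupport (b k)
      · exact (hb k).contDiffAt.mul ((hF k).contDiffAt (hU.mem_nhds (hbU k hx)))
      · refine contDiffAt_const (c := 0) |>.congr_of_eventuallyEq ?_
        filter_upwards [notMem_tsupport_iff_eventuallyEq.1 hx] with y hy
        simp [hy]
  obtain ⟨h, hh, hg, hs, hS, hd⟩ := exists_monomial_germs_summable hG fun k => (hbc k).mul_right
  -- Where `b k = 1` for all `k ≥ j`, replacing `F k` by `b k * F k` alters only finitely many
  -- terms, so smoothness transfers locally from the cut-off series.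
  have key : ∀ j x y, (∀ k ≥ j, b k x = 1) → ∑' k, F k x * h k y = ∑' k, b k x * F k x * h k y +
      ∑ k ∈ Finset.range j, (F k x - b k x * F k x) * h k y := fun j x y hj => by
    have h0 : ∀ k ∉ Finset.range j, (F k x - b k x * F k x) * h k y = 0 := fun k hk => by
      rw [hj k (by simpa using hk)]
      ring
    refine ((((hs (x, y)).hasSum.add (hasSum_sum_of_ne_finset_zero h0)).congr_fun fun k => ?_)).tsum_eq
    ring
  refine ⟨fun z => ∑' k, F k z.1 * h k z.2, fun z hz => ?_, fun k x hx => ?_⟩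
  · obtain ⟨j, hj⟩ := hb1 z.1 hz.1
    refine ContDiffAt.contDiffWithinAt (ContDiffAt.congr_of_eventuallyEq
      (hS.contDiffAt.add (ContDiffAt.sum (s := Finset.range j) (f := fun k z =>
        (F k z.1 - b k z.1 * F k z.1) * h k z.2) fun k _ => ?_)) ?_)
    · have hFz : ContDiffAt ℝ ∞ (fun z : E × ℝ => F k z.1) z :=
        ((hF k).contDiffAt (hU.mem_nhds hz.1)).comp z contDiffAt_fst
      exact (hFz.sub (((hG k).comp contDiff_fst).contDiffAt)).mul
        ((hh k).comp contDiff_snd).contDiffAt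
    · filter_upwards [continuousAt_fst.eventually hj] with w hw
      exact key j w.1 w.2 hw
  · obtain ⟨j, hj⟩ := hb1 x hx
    have hj := hj.self_of_nhds
    simp_rw [key j x _ hj]
    have hcd : ContDiff ℝ ∞ fun y => ∑' k, b k x * F k x * h k y :=
      hS.comp (contDiff_const.prodMk contDiff_id)
    have hsd : ∀ i ∈ Finset.range j, ContDiffAt ℝ k
        (fun y => (F i x - b i x * F i x) * h i y) 0 := fun i _ =>
      (contDiff_const.mul ((hh i).of_le (by exact_mod_cast le_top))).contDiffAt
    rw [iteratedDeriv_fun_add (hcd.of_le (by exact_mod_cast le_top)).contDiffAt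
      (ContDiffAt.sum hsd), hd, iteratedDeriv_fun_sum hsd]
    simp_rw [iteratedDeriv_const_mul_field, iteratedDeriv_monomial_germ (hg _)]
    simp only [mul_ite, mul_one, mul_zero, Finset.sum_ite_eq, Finset.mem_range]
    -- For `k < j` the finite correction restores `F k x`; for `k ≥ j` there is no correction, but
    -- `b k x = 1`.
    split_ifs with hk
    · ring
    · rw [hj k (not_lt.1 hk)]
      ring

/-! ### The Taylor map as a subduction -/

/-- Plots have domain `EuclideanSpace ℝ (Fin k)`, so a linear identification of the product with
such a space serves as the test plot. -/
theorem contDiff_of_dSmooth_prod {n : ℕ} {f : EuclideanSpace ℝ (Fin n) × ℝ → ℝ}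
    (hf : DSmooth f) : ContDiff ℝ ∞ f := by
  let L := toEuclidean (E := EuclideanSpace ℝ (Fin n) × ℝ)
  have hL : IsPlot L.symm := isPlot_prod_iff.2
    ⟨(contDiff_fst.comp L.symm.contDiff).isPlot, (contDiff_snd.comp L.symm.contDiff).isPlot⟩
  have h : ContDiff ℝ ∞ ((f ∘ L.symm) ∘ L) := (hf _ _ hL).contDiff.comp L.contDiff
  rwa [Function.comp_assoc, L.symm_comp_self] at h

theorem isPlot_smoothMap_iff {n : ℕ} {p : EuclideanSpace ℝ (Fin n) → SmoothMap ℝ ℝ} :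
    IsPlot p ↔ ContDiff ℝ ∞ fun z : EuclideanSpace ℝ (Fin n) × ℝ => p z.1 z.2 :=
  ⟨contDiff_of_dSmooth_prod, fun h _ _ hr => (h.comp
    ((isPlot_prod_iff.1 hr).1.contDiff.prodMk (isPlot_prod_iff.1 hr).2.contDiff)).isPlot⟩

theorem dSmooth_taylorMap : DSmooth taylorMap := fun _ _ hp => isPlot_pi_iff.2 fun k =>
  (contDiff_iteratedDeriv_curry_right (isPlot_smoothMap_iff.1 hp) k 0).isPlot

/-- Plots of the product lift to plots along the Taylor map, by Borel's theorem. -/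
theorem exists_isPlot_taylorMap_comp_eq {n : ℕ} {p : EuclideanSpace ℝ (Fin n) → ℕ → ℝ}
    (hp : IsPlot p) :
    ∃ q : EuclideanSpace ℝ (Fin n) → SmoothMap ℝ ℝ, IsPlot q ∧ taylorMap ∘ q = p := by
  obtain ⟨d, hd, h⟩ := exists_contDiffOn_iteratedDeriv_eq isOpen_univ
    (F := fun k x => p x k) fun k => (isPlot_pi_iff.1 hp k).contDiff.contDiffOn
  rw [Set.univ_prod_univ, contDiffOn_univ] at hd
  refine ⟨fun x => ⟨fun y => d (x, y), (hd.comp (contDiff_const.prodMk contDiff_id)).dSmooth⟩,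
    isPlot_smoothMap_iff.2 hd, ?_⟩
  funext x k
  exact h k x trivial

theorem surjective_taylorMap : Function.Surjective taylorMap := fun a => by
  -- The classical Borel theorem is the case of a zero-dimensional parameter space.
  obtain ⟨q, -, h⟩ := exists_isPlot_taylorMap_comp_eq (n := 0) (p := fun _ => a) isPlot_const
  exact ⟨q 0, congrFun h 0⟩

theorem isSubduction_taylorMap : IsSubduction taylorMap := by
  refine ⟨surjective_taylorMap, DiffeologicalSpace.ext ?_⟩
  funext n p
  refine propext ⟨fun hp => ?_, fun hp => ?_⟩
  · obtain ⟨q, hq, rfl⟩ := exists_isPlot_taylorMap_comp_eq hp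
    exact DiffeologicalSpace.isPlot_generatedFrom_of_mem ⟨q, hq, rfl⟩
  · refine DiffeologicalSpace.le_iff'.1 (DiffeologicalSpace.generateFrom_le_iff.2 ?_) n p hp
    rintro m r ⟨q, hq, h⟩
    rw [show r = taylorMap ∘ q from h]
    exact dSmooth_taylorMap m q hq

theorem ker_taylorMap : LinearMap.ker taylorMap = flatFunctions := by
  ext f
  exact LinearMap.mem_ker.trans funext_iff

/-- A map out of a pushforward diffeology is smooth if its composite with the quotient map is. -/
theorem dSmooth_of_dSmooth_comp {X Y Z : Type*} [dX : DiffeologicalSpace X]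
    [dY : DiffeologicalSpace Y] [DiffeologicalSpace Z] {f : X → Y} {g : Y → Z}
    (hf : IsSubduction f) (hg : DSmooth (g ∘ f)) : DSmooth g := by
  intro n p hp
  have hp' : @IsPlot Y (coinduced f dX) n p := hf.2 ▸ hp
  refine DiffeologicalSpace.locality fun x => ?_
  obtain ⟨u, hu, hxu, q, hq, h⟩ := (isPlot_coinduced_iff hf.1).1 hp' x
  refine ⟨u, hu, hxu, fun {m k} hk hk' => ?_⟩
  have : (g ∘ p) ∘ k = (g ∘ f) ∘ (q ∘ k) := funext fun y => congrArg g (h _ (hk y)).symm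
  rw [this]
  exact hg m _ (isPlot_reparam hq hk')

theorem Diffeology.IsSubduction.dSmooth {X Y : Type*} [dX : DiffeologicalSpace X]
    [dY : DiffeologicalSpace Y] {f : X → Y} (hf : IsSubduction f) : DSmooth f := by
  intro n p hp
  have h : @IsPlot Y (coinduced f dX) n (f ∘ p) :=
    DiffeologicalSpace.isPlot_generatedFrom_of_mem ⟨p, hp, rfl⟩
  rw [hf.2]
  exact h

theorem isSubduction_quotient_mk {V : Type*} [AddCommGroup V] [Module ℝ V]
    [DiffeologicalSpace V] (S : Submodule ℝ V) :
    IsSubduction fun v : V => (Submodule.Quotient.mk v : V ⧸ S) :=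
  ⟨Submodule.Quotient.mk_surjective S, rfl⟩

theorem exists_quotient_flatFunctions_equiv :
    ∃ e : (SmoothMap ℝ ℝ ⧸ flatFunctions) ≃ₗ[ℝ] (ℕ → ℝ),
      (∀ f : SmoothMap ℝ ℝ, e (Submodule.Quotient.mk f) = taylorMap f) ∧
      DSmooth e ∧ DSmooth e.symm := by
  let e : (SmoothMap ℝ ℝ ⧸ flatFunctions) ≃ₗ[ℝ] (ℕ → ℝ) :=
    (Submodule.quotEquivOfEq _ _ ker_taylorMap.symm).trans
      (taylorMap.quotKerEquivOfSurjective surjective_taylorMap)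
  have he : ∀ f : SmoothMap ℝ ℝ, e (Submodule.Quotient.mk f) = taylorMap f := fun _ => rfl
  refine ⟨e, he, dSmooth_of_dSmooth_comp (isSubduction_quotient_mk _) dSmooth_taylorMap,
    dSmooth_of_dSmooth_comp isSubduction_taylorMap ?_⟩
  -- Smoothness of the inverse is tested after the subduction `taylorMap`, where it becomes the
  -- quotient map.
  have : e.symm ∘ taylorMap = fun f => Submodule.Quotient.mk f :=
    funext fun f => e.symm_apply_eq.2 (he f).symm
  rw [this]
  exact (isSubduction_quotient_mk _).dSmooth

/-! ### Smooth curves in the product and the D-topology -/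

/-- Bump functions at a sequence of distinct points converging to `0`. -/
theorem exists_separated_bumps : ∃ (s : ℕ → ℝ) (ψ : ℕ → ℝ → ℝ),
    Filter.Tendsto s Filter.atTop (nhds 0) ∧ (∀ n, s n ∈ Set.Icc 0 1) ∧
    (∀ n, ContDiff ℝ ∞ (ψ n)) ∧ (∀ n, HasCompactSupport (ψ n)) ∧ (∀ n, ψ n 0 = 0) ∧
    ∀ m n, ψ n (s m) = if n = m then 1 else 0 := by
  -- The outer radius `2⁻⁽ⁿ⁺¹⁾` is the distance from `2⁻ⁿ` to the next point. Neighbouring supports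
  -- overlap; only the values at the chosen points and at `0` matter.
  let ψ : ∀ n : ℕ, ContDiffBump ((1 / 2 : ℝ) ^ n) := fun n =>
    ⟨(1 / 2) ^ (n + 2), (1 / 2) ^ (n + 1), by positivity,
      pow_lt_pow_right_of_lt_one₀ (by norm_num) (by norm_num) (by omega)⟩
  have hpow : ∀ {m n : ℕ}, m ≤ n → (1 / 2 : ℝ) ^ n ≤ (1 / 2) ^ m := fun h =>
    pow_le_pow_of_le_one (by norm_num) (by norm_num) h
  refine ⟨fun n => (1 / 2) ^ n, fun n => ψ n,
    tendsto_pow_atTop_nhds_zero_of_lt_one (by norm_num) (by norm_num),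
    fun n => ⟨by positivity, pow_le_one₀ (by norm_num) (by norm_num)⟩,
    fun n => (ψ n).contDiff, fun n => (ψ n).hasCompactSupport, fun n => ?_, fun m n => ?_⟩
  · refine (ψ n).zero_of_le_dist ?_
    rw [dist_zero_left, Real.norm_of_nonneg (by positivity)]
    exact hpow n.le_succ
  · split_ifs with h
    · subst h
      exact (ψ n).one_of_mem_closedBall (Metric.mem_closedBall_self (ψ n).rIn_pos.le)
    · refine (ψ n).zero_of_le_dist ?_
      change (1 / 2 : ℝ) ^ (n + 1) ≤ |(1 / 2) ^ m - (1 / 2) ^ n|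
      rcases lt_or_gt_of_ne h with h | h
      · rw [abs_sub_comm]
        refine le_trans ?_ (le_abs_self _)
        have := hpow (Nat.succ_le_of_lt h)
        rw [Nat.succ_eq_add_one] at this
        rw [pow_succ] at this ⊢
        linarith
      · refine le_trans ?_ (le_abs_self _)
        have := hpow (Nat.succ_le_of_lt h)
        rw [Nat.succ_eq_add_one] at this
        have hn : (0 : ℝ) < (1 / 2) ^ n := by positivity
        rw [pow_succ] at this ⊢
        linarith

theorem isPlot_curve {γ : ℝ → ℕ → ℝ} (hγ : ∀ i, ContDiff ℝ ∞ fun t => γ t i) :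
    IsPlot fun u : EuclideanSpace ℝ (Fin 1) => γ (u 0) :=
  isPlot_pi_iff.2 fun i => ((hγ i).comp (EuclideanSpace.proj (𝕜 := ℝ) (0 : Fin 1)).contDiff).isPlot

open Filter Topology in
/-- A fast converging sequence in `ℕ → ℝ` lies on a smooth curve. -/
theorem mem_nhds_of_isOpen_preimage_curve {A : Set (ℕ → ℝ)} {x : ℕ → ℝ} (hx : x ∈ A)
    (hA : ∀ γ : ℝ → ℕ → ℝ, (∀ i, ContDiff ℝ ∞ fun t => γ t i) → IsOpen (γ ⁻¹' A)) : A ∈ 𝓝 x := by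
  obtain ⟨s, ψ, hs, -, hψ, hψc, hψ0, hψs⟩ := exists_separated_bumps
  choose B hB using fun n => exists_bound_iteratedFDeriv (hψ n) (hψc n)
  -- `M n` bounds the derivatives of `ψ n` of order at most `n`; dividing by it below makes the
  -- series for the curve converge with all derivatives.
  let M : ℕ → ℝ := fun n => 1 + ∑ i ∈ Finset.range (n + 1), |B n i|
  have hM : ∀ n, 0 < M n := fun n => by positivity
  have hBM : ∀ n, ∀ i ≤ n, ∀ t, ‖iteratedFDeriv ℝ i (ψ n) t‖ ≤ M n := fun n i hi t =>
    (hB n i t).trans ((le_abs_self _).trans ((Finset.single_le_sum (f := fun i => |B n i|)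
      (fun _ _ => abs_nonneg _) (Finset.mem_range.2 (Nat.lt_succ_of_le hi))).trans
        (le_add_of_nonneg_left zero_le_one)))
  by_contra hcon
  have hz : ∀ n : ℕ, ∃ z ∉ A, ∀ i ≤ n, |z i - x i| ≤ (1 / 2) ^ n / M n := fun n => by
    by_contra! h
    refine hcon ?_
    have hev : ∀ᶠ z in 𝓝 x, ∀ i ∈ Finset.range (n + 1), |z i - x i| < (1 / 2) ^ n / M n := by
      refine (Filter.eventually_all_finset _).2 fun i _ => ?_
      have hc : Continuous fun z : ℕ → ℝ => |z i - x i| := by fun_prop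
      refine hc.continuousAt.eventually_lt continuousAt_const ?_
      have := hM n
      simp only [sub_self, abs_zero]
      positivity
    filter_upwards [hev] with z hzx
    by_contra hzA
    obtain ⟨i, hi, hlt⟩ := h z hzA
    exact hlt.not_ge (hzx i (Finset.mem_range.2 (Nat.lt_succ_of_le hi))).le
  choose z hzA hzx using hz
  -- This curve takes the value `x` at `0` and `z m` at `s m`. As `s m → 0` and the preimage of `A`
  -- is open, some `z m` would lie in `A`.
  let γ : ℝ → ℕ → ℝ := fun t i => x i + ∑' n, (z n i - x i) * ψ n t
  have hγ : ∀ i, ContDiff ℝ ∞ fun t => γ t i := fun i => by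
    refine contDiff_const.add (contDiff_tsum_of_eventually (N := ⊤) (v := fun _ n => (1 / 2) ^ n)
      (fun n => contDiff_const.mul (hψ n)) (fun _ _ => summable_geometric_two) fun k _ => ?_)
    rw [Nat.cofinite_eq_atTop]
    -- Coordinate `i` of `z n` is controlled only for `n ≥ i`, and the order `k` only for `n ≥ k`.
    filter_upwards [eventually_ge_atTop (max i k)] with n hn t
    have h1 : iteratedFDeriv ℝ k (fun t => (z n i - x i) * ψ n t) t =
        (z n i - x i) • iteratedFDeriv ℝ k (ψ n) t :=
      iteratedFDeriv_const_smul_apply (a := z n i - x i) ((hψ n).of_le (by exact_mod_cast le_top)).contDiffAt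
    rw [h1, norm_smul, Real.norm_eq_abs]
    refine (mul_le_mul (hzx n i ((le_max_left _ _).trans hn))
      (hBM n k ((le_max_right _ _).trans hn) t) (norm_nonneg _)
      (by have := hM n; positivity)).trans_eq ?_
    exact div_mul_cancel₀ _ (hM n).ne'
  have h0 : γ 0 = x := by
    funext i
    simp [γ, hψ0]
  have hγs : ∀ m, γ (s m) = z m := fun m => by
    funext i
    simp [γ, hψs]
  have hev := hs.eventually ((hA γ hγ).mem_nhds (x := 0) (by rwa [Set.mem_preimage, h0]))
  obtain ⟨m, hm⟩ := hev.exists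
  rw [hγs] at hm
  exact hzA m hm

/-- Plots are continuous in each coordinate, which gives one inclusion; for the other,
one-dimensional plots already suffice. -/
theorem dTopology_nat_pi :
    (DiffeologicalSpace.dTopology : TopologicalSpace (ℕ → ℝ)) = Pi.topologicalSpace := by
  refine TopologicalSpace.ext_iff.2 fun A => ⟨fun hA => ?_, fun hA => ?_⟩
  · refine isOpen_iff_mem_nhds.2 fun x hx => mem_nhds_of_isOpen_preimage_curve hx fun γ hγ => ?_
    have h := isOpen_iff_preimages_plots.1 hA 1 _ (isPlot_curve hγ)
    exact h.preimage (f := fun t : ℝ => WithLp.toLp 2 fun _ : Fin 1 => t) (by fun_prop)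
  · refine isOpen_iff_preimages_plots.2 fun n p hp => hA.preimage ?_
    exact continuous_pi fun i => (isPlot_pi_iff.1 hp i).contDiff.continuous

/-! ### Absence of smooth sections and splittings -/

theorem not_exists_dSmooth_section_taylorMap :
    ¬ ∃ q : (ℕ → ℝ) →ₗ[ℝ] SmoothMap ℝ ℝ, DSmooth q ∧ taylorMap ∘ₗ q = LinearMap.id := by
  rintro ⟨q, hq, hid⟩
  obtain ⟨s, ψ, -, hs, hψ, -, -, hψs⟩ := exists_separated_bumps
  let e : ℕ → ℕ → ℝ := fun n => Pi.single n 1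
  -- The `n`-th derivative of `q (e n)` at `0` is `1`, so `q (e n)` cannot vanish on a neighbourhood
  -- of `0`.
  have ht : ∀ n, ∃ t ∈ Set.Icc (-1 : ℝ) 1, q (e n) t ≠ 0 := fun n => by
    by_contra! h
    have h0 : (q (e n) : ℝ → ℝ) =ᶠ[nhds 0] fun _ => 0 := by
      filter_upwards [Icc_mem_nhds (by norm_num : (-1 : ℝ) < 0) one_pos] with t ht
      exact h t ht
    have h1 : iteratedDeriv n (q (e n)) 0 = e n n := congrFun (LinearMap.congr_fun hid (e n)) n
    rw [h0.iteratedDeriv_eq] at h1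
    simp [e] at h1
  choose t ht htq using ht
  -- Smooth in each coordinate, with no growth condition across coordinates. The coefficient makes
  -- `q (γ (s n)) (t n) = n`, with all `(s n, t n)` in one compact rectangle.
  let γ : ℝ → ℕ → ℝ := fun u n => n / q (e n) (t n) * ψ n u
  have hγs : ∀ n, γ (s n) = (n / q (e n) (t n)) • e n := fun n => by
    funext i
    by_cases h : i = n
    · subst h
      simp [γ, e, hψs]
    · simp [γ, e, hψs, h]
  have hQ := isPlot_smoothMap_iff.1 (hq _ _ (isPlot_curve (γ := γ)
    fun n => contDiff_const.mul (hψ n)))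
  have hc : Continuous fun w : ℝ × ℝ => q (γ w.1) w.2 :=
    hQ.continuous.comp (f := fun w : ℝ × ℝ => (WithLp.toLp 2 fun _ : Fin 1 => w.1, w.2))
      (by fun_prop)
  obtain ⟨C, hC⟩ := (isCompact_Icc.prod isCompact_Icc).exists_bound_of_continuousOn
    (s := Set.Icc (0 : ℝ) 1 ×ˢ Set.Icc (-1 : ℝ) 1) hc.continuousOn
  obtain ⟨n, hn⟩ := exists_nat_gt C
  have h := hC (s n, t n) ⟨hs n, ht n⟩
  rw [hγs, map_smul, SmoothMap.coe_smul, Pi.smul_apply, smul_eq_mul,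
    div_mul_cancel₀ _ (htq n)] at h
  exact absurd ((le_abs_self _).trans h) (not_le.2 hn)

theorem isShortExact_taylorMap : IsShortExact flatFunctions.subtype taylorMap where
  dSmooth_left _ _ hp := hp
  dSmooth_right := dSmooth_taylorMap
  injective := flatFunctions.injective_subtype
  exact := LinearMap.exact_iff.2 (by rw [ker_taylorMap, Submodule.range_subtype])
  surjective := surjective_taylorMap
  isInduction := ⟨flatFunctions.injective_subtype, rfl⟩
  isSubduction := isSubduction_taylorMap

/-- In a short exact sequence, a smooth linear retraction of the inclusion gives a smooth linear
section of the projection. -/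
theorem Diffeology.IsShortExact.exists_section_of_retraction {A V B : Type*} [AddCommGroup A] [Module ℝ A]
    [DiffeologicalSpace A] [DiffeologicalVectorSpace A] [AddCommGroup V] [Module ℝ V]
    [DiffeologicalSpace V] [DiffeologicalVectorSpace V] [AddCommGroup B] [Module ℝ B]
    [DiffeologicalSpace B] [DiffeologicalVectorSpace B] {i : A →ₗ[ℝ] V} {p : V →ₗ[ℝ] B}
    (h : IsShortExact i p) {r : V →ₗ[ℝ] A} (hr : DSmooth r) (hri : r ∘ₗ i = LinearMap.id) :
    ∃ q : B →ₗ[ℝ] V, DSmooth q ∧ p ∘ₗ q = LinearMap.id := by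
  -- `id - i r` kills the image of `i`, which is the kernel of `p`, so it descends to `B`; it
  -- changes `v` only by an element of that kernel, so the descended map is a section.
  let g : V →ₗ[ℝ] V := LinearMap.id - i ∘ₗ r
  have hker : LinearMap.ker p ≤ LinearMap.ker g := fun v hv => by
    obtain ⟨a, rfl⟩ := (h.exact v).1 hv
    have : r (i a) = a := LinearMap.congr_fun hri a
    simp [g, this]
  let q : B →ₗ[ℝ] V :=
    (LinearMap.ker p).liftQ g hker ∘ₗ (p.quotKerEquivOfSurjective h.surjective).symm.toLinearMap
  have hq : ∀ v, q (p v) = g v := fun v => by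
    have : (p.quotKerEquivOfSurjective h.surjective).symm (p v) = Submodule.Quotient.mk v :=
      (LinearEquiv.symm_apply_eq _).2 rfl
    simp only [q, LinearMap.comp_apply, LinearEquiv.coe_coe, this]
    rfl
  refine ⟨q, dSmooth_of_dSmooth_comp h.isSubduction ?_, LinearMap.ext fun b => ?_⟩
  · rw [show q ∘ p = g from funext hq]
    intro n c hc
    have h1 := isPlot_add hc (isPlot_smul (isPlot_const (x := (-1 : ℝ)))
      (h.dSmooth_left _ _ (hr _ _ hc)))
    convert h1 using 2 with x
    simp [g, sub_eq_add_neg]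
  · obtain ⟨v, rfl⟩ := h.surjective b
    rw [LinearMap.comp_apply, hq, LinearMap.id_apply]
    have : p (i (r v)) = 0 := h.exact.apply_apply_eq_zero _
    simp [g, this]

theorem Diffeology.SplitsSmoothly.exists_retraction {A V B : Type*} [AddCommGroup A] [Module ℝ A]
    [DiffeologicalSpace A] [DiffeologicalVectorSpace A] [AddCommGroup V] [Module ℝ V]
    [DiffeologicalSpace V] [DiffeologicalVectorSpace V] [AddCommGroup B] [Module ℝ B]
    [DiffeologicalSpace B] [DiffeologicalVectorSpace B] {i : A →ₗ[ℝ] V} {p : V →ₗ[ℝ] B}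
    (h : SplitsSmoothly i p) : ∃ r : V →ₗ[ℝ] A, DSmooth r ∧ r ∘ₗ i = LinearMap.id := by
  obtain ⟨e, he, -, hi, -⟩ := h
  refine ⟨LinearMap.fst ℝ A B ∘ₗ e.toLinearMap,
    fun n c hc => (isPlot_prod_iff.1 (he n c hc)).1, LinearMap.ext fun a => ?_⟩
  simp [hi]

theorem not_exists_dSmooth_retraction_flatFunctions :
    ¬ ∃ r : SmoothMap ℝ ℝ →ₗ[ℝ] flatFunctions,
      DSmooth r ∧ r ∘ₗ flatFunctions.subtype = LinearMap.id := fun ⟨_, hr, hri⟩ =>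
  not_exists_dSmooth_section_taylorMap
    (isShortExact_taylorMap.exists_section_of_retraction hr hri)

theorem mainTheorem4 :
    -- the Taylor map is a smooth linear map and a subduction, with kernel the flat functions
    DSmooth taylorMap ∧ IsSubduction taylorMap ∧ LinearMap.ker taylorMap = flatFunctions ∧
    -- the induced bijection from the quotient is an isomorphism of diffeological vector spaces
    (∃ e : (SmoothMap ℝ ℝ ⧸ flatFunctions) ≃ₗ[ℝ] (ℕ → ℝ),
      (∀ f : SmoothMap ℝ ℝ, e (Submodule.Quotient.mk f) = taylorMap f) ∧
      DSmooth e ∧ DSmooth e.symm) ∧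
    -- the generalized Borel theorem, with parameters in an open set
    (∀ (m : ℕ) (U : Set (EuclideanSpace ℝ (Fin m))), IsOpen U →
      ∀ F : ℕ → EuclideanSpace ℝ (Fin m) → ℝ, (∀ k, ContDiffOn ℝ ∞ (F k) U) →
      ∃ d : EuclideanSpace ℝ (Fin m) × ℝ → ℝ, ContDiffOn ℝ ∞ d (U ×ˢ Set.univ) ∧
        ∀ k : ℕ, ∀ x ∈ U, iteratedDeriv k (fun y : ℝ => d (x, y)) 0 = F k x) ∧
    -- the D-topology of the product is the product topology
    (DiffeologicalSpace.dTopology : TopologicalSpace (ℕ → ℝ)) = Pi.topologicalSpace ∧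
    -- there is no smooth linear section
    (¬ ∃ q : (ℕ → ℝ) →ₗ[ℝ] SmoothMap ℝ ℝ, DSmooth q ∧ taylorMap ∘ₗ q = LinearMap.id) ∧
    -- the short exact sequence, which does not split smoothly
    IsShortExact flatFunctions.subtype taylorMap ∧
    (¬ ∃ r : SmoothMap ℝ ℝ →ₗ[ℝ] flatFunctions,
      DSmooth r ∧ r ∘ₗ flatFunctions.subtype = LinearMap.id) ∧
    ¬ SplitsSmoothly flatFunctions.subtype taylorMap := ⟨dSmooth_taylorMap, isSubduction_taylorMap, ker_taylorMap,
    exists_quotient_flatFunctions_equiv,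
    fun _ _ hU _ hF => exists_contDiffOn_iteratedDeriv_eq hU hF, dTopology_nat_pi,
    not_exists_dSmooth_section_taylorMap, isShortExact_taylorMap,
    not_exists_dSmooth_retraction_flatFunctions,
    fun h => not_exists_dSmooth_retraction_flatFunctions h.exists_retraction⟩
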